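/- Consider the square grid. Its faces are labelled by $\mathbb Z^2$; a face $(i,j)$ is even if $i+j$ is even and odd otherwise, so every edge lies on exactly one even face. The face $(0,0)$ has a black top-left vertex in the bipartite colouring. A dimer covering is a set of edges containing exactly one edge at every vertex. Fix $a>0$ and give horizontal edges weight $1$ and vertical edges weight $\sqrt a$. One domino shuffle acts on dimer coverings of the plane as follows, using i.i.d. marks $\omega(f)\in\{0,1\}$ indexed by the faces $f$, with $P(\omega(f)=1)=\frac1{1+a}$, independent of the covering. First, perform at every even face a spider move followed by contraction of the 2-valent vertices: if the face has exactly one of its four edges in the covering, this dimer is moved to the opposite side of the face; if it has two (necessarily parallel) dimers, both are removed; if it has none, its two horizontal edges are added when $\omega(f)=1$ and its two vertical edges are added when $\omega(f)=0$. Then do the same at every odd face. For $n\ge1$ let $G_n$ be the torus obtained from the grid by dividing out the translations by $(2n,0)$ and $(0,2n)$. Given positive numbers $w=(w_n,w_e,w_s,w_w)$, give the north, east, south, west edges of every even face these weights. Call $w$ gauge-modified if, on the plane, these edge weights arise from the original ones by a gauge transformation (multiplication of all edge weights at each vertex by a positive constant). Let $\mu_n^w$ be the Boltzmann measure on dimer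 coverings of $G_n$, $\mu_n^w[M]\propto\prod_{e\in M}w(e)$, viewed as the law of a periodic covering of the plane. Let $\rho=(\rho_1,\rho_2)\in U^\circ$, the interior of $U=\{|\rho_1|+|\rho_2|\le2\}$. A Gibbs measure $\pi_\rho$ is a weak limit, along some sequence of tori $G_{n_k}$ with $n_k\to\infty$ strictly increasing, of the measures $\mu_{n_k}^w$, where $w=(\sin\alpha,\sin\beta,\sin\gamma,\sin\delta)$ is gauge-modified, $\alpha,\beta,\gamma,\delta>0$, $\alpha+\beta+\gamma+\delta=\pi$, $\rho_1=2\frac{\beta-\delta}{\pi}$ and $\rho_2=2\frac{\gamma-\alpha}{\pi}$. Proposition. For every $a>0$ and $\rho\in U^\circ$, a Gibbs measure $\pi_\rho$ exists, and every such $\pi_\rho$ is invariant under shuffling: if a covering has law $\pi_\rho$, then so has the covering after one shuffle. Likewise, for every gauge-modified $w$, a weak limit $\pi$ of $\mu^w_{n_k}$ (with $n_k$ strictly increasing) whose expected height change per unit step is $\rho$, that is, $\rho_1=2(\pi(e_x)-\pi(w_x))$ and $\rho_2=2(\pi(s_x)-\pi(n_x))$ for every even face $x$, where $\pi(n_x),\pi(e_x),\pi(s_x),\pi(w_x)$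 are the probabilities that the north, east, south, west edge of $x$ is a dimer, is invariant under shuffling. -/

import Mathlib

open MeasureTheory ProbabilityTheory Filter Topology

namespace Domino

/-! ### The square grid, on the plane and on tori

Faces and vertices are both labelled by `R × R`, with `R = ℤ` for the plane and `R = ZMod (2 * n)`
for the torus obtained from the plane by dividing out the translations by `(2n, 0)` and `(0, 2n)`.
The vertex labelled `v` is the north-east corner of the face labelled `v`. -/

/-- The four sides of a face, which are also the four directions in which edges leave a vertex. -/
inductive Side
  | north | east | south | west
  deriving DecidableEq

/-- The opposite side. -/
def Side.opp : Side → Side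
  | .north => .south
  | .east => .west
  | .south => .north
  | .west => .east

/-- `Sum.inl f` is the horizontal edge on the north side of the face `f`, joining the vertices
`f - (1, 0)` and `f`; `Sum.inr f` is the vertical edge on the east side of `f`, joining the
vertices `f - (0, 1)` and `f`. -/
abbrev Edge (R : Type) := (R × R) ⊕ (R × R)

section Grid

variable {R : Type} [CommRing R]

/-- The two end vertices of an edge. -/
def ends : Edge R → (R × R) × (R × R)
  | .inl f => ((f.1 - 1, f.2), f)
  | .inr f => ((f.1, f.2 - 1), f)

/-- The edge on a given side of the face `f`. -/
def faceEdge (f : R × R) : Side → Edge R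
  | .north => .inl f
  | .east => .inr f
  | .south => .inl (f.1, f.2 - 1)
  | .west => .inr (f.1 - 1, f.2)

/-- The edge that leaves the vertex `v` in a given direction. -/
def vertexEdge (v : R × R) : Side → Edge R
  | .north => .inr (v.1, v.2 + 1)
  | .east => .inl (v.1 + 1, v.2)
  | .south => .inr v
  | .west => .inl v

/-- A set of edges (given by its indicator function) is a dimer covering if exactly one of the four
edges at every vertex belongs to it. -/
def IsCovering (M : Edge R → Bool) : Prop :=
  ∀ v : R × R, ∃! d : Side, M (vertexEdge v d) = true

/-- The dimer coverings, as a subspace of the product space `Edge R → Bool`. -/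
abbrev DimerCovering (R : Type) [CommRing R] := {M : Edge R → Bool // IsCovering M}

/-- The even faces; the other faces are the odd ones. On a torus this is meaningful because the
side lengths `2n` are even. -/
def IsEvenFace (f : R × R) : Prop := Even (f.1 + f.2)

open Classical in
/-- If `A` is the set of even faces or the set of odd faces, every edge `e` is on the boundary of
exactly one face in `A`. This is that face, and the side of it on which `e` is. -/
noncomputable def owner (A : R × R → Prop) : Edge R → (R × R) × Side
  | .inl f => if A f then (f, .north) else ((f.1, f.2 + 1), .south)
  | .inr f => if A f then (f, .east) else ((f.1 + 1, f.2), .west)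

/-! ### Edge weights and gauge transformations -/

/-- The edge weights on the grid that are the same around every even face, with weight `w d` on
side `d`. -/
noncomputable def edgeWeight (w : Side → ℝ) (e : Edge R) : ℝ := w (owner IsEvenFace e).2

/-- Two edge weights are gauge equivalent if one is obtained from the other by multiplying all the
edges at each vertex by a positive constant. -/
def GaugeEquivalent (w w' : Edge R → ℝ) : Prop :=
  ∃ g : R × R → ℝ, (∀ v, 0 < g v) ∧ ∀ e, w' e = g (ends e).1 * g (ends e).2 * w e

/-- The original edge weights: `1` on the horizontal and `√a` on the vertical edges. -/
noncomputable def originalWeight (a : ℝ) : Edge R → ℝ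
  | .inl _ => 1
  | .inr _ => Real.sqrt a

/-! ### The shuffle -/

open Classical in
/-- The spider move at a face, followed by vertex contraction, in terms of the four edges of the
face. The old dimers on the face are `X`; the result is the set of new dimers.
If there are old dimers, a single one moves to the opposite side and a parallel pair disappears.
If there are none, a parallel pair is created: the horizontal one if `ω` is true and the vertical
one otherwise. (Contraction deletes the dimers on the tentacles and keeps those on the four inner
edges.) -/
noncomputable def spider (ω : Bool) (X : Side → Bool) (d : Side) : Bool :=
  if ∃ d', X d' = true then X d.opp && !(X d)
  else if d = .north ∨ d = .south then ω else !ω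

/-- Spider moves at all faces in `A` (the even faces or the odd faces), followed by the contraction
of all 2-valent vertices, with the mark `ω f` used at the face `f`. -/
noncomputable def spiderRound (A : R × R → Prop) (ω : R × R → Bool) (M : Edge R → Bool) :
    Edge R → Bool := fun e =>
  spider (ω (owner A e).1) (fun d => M (faceEdge (owner A e).1 d)) (owner A e).2

theorem existsUnique_side (p : Side → Bool) : (∃! d, p d = true) ↔
    ((p .north && !p .east && !p .south && !p .west) ||
     (!p .north && p .east && !p .south && !p .west) ||
     (!p .north && !p .east && p .south && !p .west) ||
     (!p .north && !p .east && !p .south && p .west)) = true := by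
  constructor
  · rintro ⟨d, hd, hu⟩
    have key : ∀ y, y ≠ d → p y = false := fun y hy =>
      Bool.eq_false_iff.2 fun h => hy (hu y h)
    clear hu
    cases d <;> simp [hd, key]
  · intro h
    have key : ∃ d, p d = true ∧ ∀ y, p y = true → y = d := by
      simp only [Bool.or_eq_true, Bool.and_eq_true, Bool.not_eq_true'] at h
      rcases h with ((h | h) | h) | h
      · exact ⟨.north, h.1.1.1, fun y hy => by cases y <;> simp_all⟩
      · exact ⟨.east, h.1.1.2, fun y hy => by cases y <;> simp_all⟩
      · exact ⟨.south, h.1.2, fun y hy => by cases y <;> simp_all⟩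
      · exact ⟨.west, h.2, fun y hy => by cases y <;> simp_all⟩
    exact key

theorem exists_side (p : Side → Bool) : (∃ d, p d = true) ↔
    (p .north || p .east || p .south || p .west) = true := by
  constructor
  · rintro ⟨d, hd⟩
    cases d <;> simp [hd]
  · intro h
    simp only [Bool.or_eq_true] at h
    rcases h with ((h | h) | h) | h
    exacts [⟨_, h⟩, ⟨_, h⟩, ⟨_, h⟩, ⟨_, h⟩]

theorem spiderRound_isCovering {A : R × R → Prop}
    (h1 : ∀ f : R × R, A (f.1 + 1, f.2) ↔ ¬ A f) (h2 : ∀ f : R × R, A (f.1, f.2 + 1) ↔ ¬ A f)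
    (ω : R × R → Bool) {M : Edge R → Bool} (hM : IsCovering M) :
    IsCovering (spiderRound A ω M) := by
  rintro ⟨i, j⟩
  have a1 := h1 (i, j)
  have a2 := h2 (i, j)
  have b0 := (existsUnique_side _).1 (hM (i, j))
  rw [existsUnique_side]
  simp only [vertexEdge] at a1 a2 b0 ⊢
  by_cases hA : A (i, j)
  · -- the faces in `A` at this vertex are `(i, j)` and `(i + 1, j + 1)`
    have c1 := (existsUnique_side _).1 (hM (i - 1, j))
    have c2 := (existsUnique_side _).1 (hM (i, j - 1))
    have c3 := (existsUnique_side _).1 (hM (i + 1, j))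
    have c4 := (existsUnique_side _).1 (hM (i, j + 1))
    have c5 := (existsUnique_side _).1 (hM (i - 1, j - 1))
    have c6 := (existsUnique_side _).1 (hM (i + 1, j + 1))
    simp only [hA, not_true_eq_false, iff_false] at a1 a2
    simp only [vertexEdge, sub_add_cancel] at c1 c2 c3 c4 c5 c6
    simp only [spiderRound, owner, hA, a1, a2, if_true, if_false, spider, exists_side, faceEdge,
      Side.opp, add_sub_cancel_right]
    clear h1 h2 hM hA a1 a2
    grind
  · -- the faces in `A` at this vertex are `(i + 1, j)` and `(i, j + 1)`
    have c1 := (existsUnique_side _).1 (hM (i + 1, j))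
    have c2 := (existsUnique_side _).1 (hM (i + 1, j - 1))
    have c3 := (existsUnique_side _).1 (hM (i, j - 1))
    have c4 := (existsUnique_side _).1 (hM (i, j + 1))
    have c5 := (existsUnique_side _).1 (hM (i - 1, j))
    have c6 := (existsUnique_side _).1 (hM (i - 1, j + 1))
    simp only [hA, not_false_eq_true, iff_true] at a1 a2
    simp only [vertexEdge, sub_add_cancel] at c1 c2 c3 c4 c5 c6
    simp only [spiderRound, owner, hA, a1, a2, if_true, if_false, spider, exists_side, faceEdge,
      Side.opp, add_sub_cancel_right]
    clear h1 h2 hM hA a1 a2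
    grind

end Grid

theorem isEvenFace_int_fst (f : ℤ × ℤ) : IsEvenFace (f.1 + 1, f.2) ↔ ¬ IsEvenFace f := by
  simp only [IsEvenFace, Int.even_iff]; omega

theorem isEvenFace_int_snd (f : ℤ × ℤ) : IsEvenFace (f.1, f.2 + 1) ↔ ¬ IsEvenFace f := by
  simp only [IsEvenFace, Int.even_iff]; omega

/-- One domino shuffle of a dimer covering of the plane, with marks `ω`: spider moves at all even
faces, contraction, spider moves at all odd faces, contraction. -/
noncomputable def shuffle (M : DimerCovering ℤ) (ω : ℤ × ℤ → Bool) : DimerCovering ℤ :=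
  ⟨spiderRound (fun f => ¬ IsEvenFace f) ω (spiderRound IsEvenFace ω M.1),
    spiderRound_isCovering (fun f => not_congr (isEvenFace_int_fst f))
      (fun f => not_congr (isEvenFace_int_snd f)) ω
      (spiderRound_isCovering isEvenFace_int_fst isEvenFace_int_snd ω M.2)⟩

/-- The law of the marks: independent over the faces, and true with probability `1 / (1 + a)`. -/
noncomputable def markMeasure (a : ℝ) (ha : 0 < a) : Measure (ℤ × ℤ → Bool) :=
  Measure.infinitePi fun _ => bernoulliMeasure true false
    ⟨1 / (1 + a), by positivity, (div_le_one (by positivity)).2 (by linarith)⟩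

/-- A probability measure on dimer coverings of the plane is invariant under shuffling if one
shuffle of a covering with this law, with marks independent of the covering, has the same law. -/
def ShuffleInvariant (a : ℝ) (ha : 0 < a) (π : ProbabilityMeasure (DimerCovering ℤ)) : Prop :=
  ((π : Measure (DimerCovering ℤ)).prod (markMeasure a ha)).map (fun p => shuffle p.1 p.2) =
    (π : Measure (DimerCovering ℤ))

/-! ### Boltzmann measures on tori -/

theorem isEvenFace_zmod (n : ℕ) (f : ZMod (2 * n) × ZMod (2 * n)) :
    IsEvenFace f ↔ ZMod.castHom (Dvd.intro n rfl) (ZMod 2) (f.1 + f.2) = 0 := by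
  constructor
  · rintro ⟨r, hr⟩
    rw [hr, map_add]
    generalize ZMod.castHom _ (ZMod 2) r = x
    revert x
    decide
  · intro h
    obtain ⟨k, hk⟩ := ZMod.intCast_surjective (f.1 + f.2)
    rw [← hk, map_intCast, ZMod.intCast_zmod_eq_zero_iff_dvd] at h
    obtain ⟨l, hl⟩ := h
    refine ⟨(l : ZMod (2 * n)), ?_⟩
    rw [← hk, hl]
    push_cast
    ring

/-- The torus has a dimer covering: the north sides of all the even faces. -/
theorem exists_torus_covering (n : ℕ) : Nonempty (DimerCovering (ZMod (2 * n))) := by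
  classical
  refine ⟨⟨fun e => match e with
    | .inl f => decide (IsEvenFace f)
    | .inr _ => false, ?_⟩⟩
  rintro ⟨i, j⟩
  have h : IsEvenFace (i + 1, j) ↔ ¬ IsEvenFace (i, j) := by
    rw [isEvenFace_zmod, isEvenFace_zmod]
    simp only [map_add, map_one]
    generalize ZMod.castHom _ (ZMod 2) i = x
    generalize ZMod.castHom _ (ZMod 2) j = y
    revert x y
    decide
  rw [existsUnique_side]
  simp only [vertexEdge]
  by_cases hh : IsEvenFace (i, j) <;> simp [h, hh]

section Torus

variable (n : ℕ+)

instance : NeZero (2 * (n : ℕ)) := ⟨by positivity⟩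

noncomputable instance : Fintype (DimerCovering (ZMod (2 * (n : ℕ)))) := Fintype.ofFinite _

/-- The total weight of a dimer covering: the product of the weights of its dimers. -/
noncomputable def coveringWeight (w : Side → ℝ) (M : DimerCovering (ZMod (2 * (n : ℕ)))) : ℝ :=
  ∏ e with M.1 e = true, edgeWeight w e

/-- The partition function. -/
noncomputable def partitionFunction (w : Side → ℝ) : ℝ :=
  ∑ M : DimerCovering (ZMod (2 * (n : ℕ))), coveringWeight n w M

variable {w : Side → ℝ}

theorem coveringWeight_pos (hw : ∀ d, 0 < w d) (M : DimerCovering (ZMod (2 * (n : ℕ)))) :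
    0 < coveringWeight n w M :=
  Finset.prod_pos fun _ _ => hw _

theorem partitionFunction_pos (hw : ∀ d, 0 < w d) : 0 < partitionFunction n w := by
  obtain ⟨M⟩ := exists_torus_covering n
  exact Finset.sum_pos (fun M _ => coveringWeight_pos n hw M) ⟨M, Finset.mem_univ _⟩

/-- The Boltzmann measure on the dimer coverings of the torus. -/
noncomputable def boltzmann (hw : ∀ d, 0 < w d) : PMF (DimerCovering (ZMod (2 * (n : ℕ)))) :=
  PMF.ofFintype (fun M => ENNReal.ofReal (coveringWeight n w M / partitionFunction n w)) (by
    have hZ := partitionFunction_pos n hw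
    rw [← ENNReal.ofReal_sum_of_nonneg
      (fun M _ => div_nonneg (coveringWeight_pos n hw M).le hZ.le), ← Finset.sum_div]
    rw [show (∑ M, coveringWeight n w M) = partitionFunction n w from rfl, div_self hZ.ne',
      ENNReal.ofReal_one])

/-- The projection of the edges of the plane to the edges of the torus. -/
def projEdge : Edge ℤ → Edge (ZMod (2 * (n : ℕ)))
  | .inl f => .inl ((f.1 : ZMod (2 * (n : ℕ))), (f.2 : ZMod (2 * (n : ℕ))))
  | .inr f => .inr ((f.1 : ZMod (2 * (n : ℕ))), (f.2 : ZMod (2 * (n : ℕ))))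

/-- The lift of a dimer covering of the torus to a periodic dimer covering of the plane. -/
def lift (M : DimerCovering (ZMod (2 * (n : ℕ)))) : DimerCovering ℤ :=
  ⟨fun e => M.1 (projEdge n e), fun v => by
    have h : ∀ d, projEdge n (vertexEdge v d) =
        vertexEdge ((v.1 : ZMod (2 * (n : ℕ))), (v.2 : ZMod (2 * (n : ℕ)))) d := by
      intro d
      cases d <;> simp [projEdge, vertexEdge]
    simp only [h]
    exact M.2 _⟩

/-- The Boltzmann measure on the torus, as the law of a periodic dimer covering of the plane. -/
noncomputable def boltzmannPlane (hw : ∀ d, 0 < w d) : ProbabilityMeasure (DimerCovering ℤ) :=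
  ⟨((boltzmann n hw).map (lift n)).toMeasure, inferInstance⟩

end Torus

/-! ### The Gibbs measures -/

/-- `π` is a weak limit, along a sequence of tori of increasing sizes, of the Boltzmann measures for
positive edge weights that on the plane are gauge equivalent to the original ones. -/
def IsBoltzmannLimit (a : ℝ) (w : Side → ℝ) (π : ProbabilityMeasure (DimerCovering ℤ)) : Prop :=
  GaugeEquivalent (originalWeight a) (edgeWeight w : Edge ℤ → ℝ) ∧
    ∃ (hw : ∀ d, 0 < w d) (n : ℕ → ℕ+), StrictMono n ∧
      Tendsto (fun k => boltzmannPlane (n k) hw) atTop (𝓝 π)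

/-- The slope of `π` is `ρ`: these are the expected height changes per unit step in the two
coordinate directions, for the height function whose increments across an edge are `3` or `-1` when
the white vertex is on the left (the north-west and south-east vertices of the even faces are
black). -/
def HasSlope (π : ProbabilityMeasure (DimerCovering ℤ)) (ρ : ℝ × ℝ) : Prop :=
  let P (f : ℤ × ℤ) (d : Side) : ℝ :=
    (π : Measure (DimerCovering ℤ)).real {M | M.1 (faceEdge f d) = true}
  ∀ f : ℤ × ℤ, IsEvenFace f →
    ρ.1 = 2 * (P f .east - P f .west) ∧ ρ.2 = 2 * (P f .south - P f .north)

/-- The region bounded by the rescaled Newton polygon. -/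
def newtonPolygon : Set (ℝ × ℝ) := {ρ | |ρ.1| + |ρ.2| ≤ 2}

/-- The weights `sin α, sin β, sin γ, sin δ` on the north, east, south, west sides. -/
noncomputable def sineWeight (α β γ δ : ℝ) : Side → ℝ
  | .north => Real.sin α
  | .east => Real.sin β
  | .south => Real.sin γ
  | .west => Real.sin δ

/-- `π` is a Gibbs measure `π_ρ`: a weak limit of Boltzmann measures on tori for the gauge-modified
weights that are the sines of angles `α, β, γ, δ` (half the central angles of the sides of an
inscribed quadrilateral), where the slope, computed from the probabilities
`α / π, β / π, γ / π, δ / π` of the four edges of an even face, is `ρ`. -/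
def IsSlopeGibbs (a : ℝ) (ρ : ℝ × ℝ) (π : ProbabilityMeasure (DimerCovering ℤ)) : Prop :=
  ∃ α β γ δ : ℝ, 0 < α ∧ 0 < β ∧ 0 < γ ∧ 0 < δ ∧ α + β + γ + δ = Real.pi ∧
    ρ.1 = 2 * ((β - δ) / Real.pi) ∧ ρ.2 = 2 * ((γ - α) / Real.pi) ∧
    IsBoltzmannLimit a (sineWeight α β γ δ) π

end Domino

/-!
A spider move at a face, with independent marks of the right law, maps Boltzmann weights to
Boltzmann weights (`Domino.spider_transfer`). For the edge weights `w` around every even face the right law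
gives `true` the probability `w_n w_s / (w_n w_s + w_e w_w)`, and for gauge-modified weights this is
`1 / (1 + a)`, because `a w_n w_s = w_e w_w` (`Domino.GaugeEquivalent.mul_eq`). On a torus, spider
moves at all faces of one parity can be undone by spider moves at the same faces, so the coverings
that are sent to a given covering are found independently at each face, and the statement for one
face gives the statement for a round (`Domino.Alternating.spiderRound_transfer`). The first round
exchanges opposite weights around the even faces, up to a constant; hence the north, east, south,
west sides of the odd faces then have weights proportional to `w`, and the second round restores the
original weights. Since the two rounds use disjoint sets of marks, the Boltzmann measure on the
torus is invariant under the shuffle of the torus (`Domino.torusShuffle_transfer`).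

In the plane the marks are not periodic. But a shuffle is local: the edges in a finite window after
the shuffle depend on finitely many marks only, and on a large torus these lie in a fundamental
domain, where the independent marks of the plane and of the torus have the same law. So the laws of
the lifted covering before and after the shuffle agree on a fixed window as soon as the torus is
large (`Domino.boltzmannPlane_shuffle`). As the shuffle is continuous in the covering and the marks,
this passes to weak limits (`Domino.shuffleInvariant_of_tendsto`).

For existence, the space of coverings is compact and metrizable, hence so is the space of its
probability measures. Angles with the required slope and with gauge-modified sines are given by an
explicit value of `cos (β + δ)` (`Domino.exists_angles`), and `a w_n w_s = w_e w_w` is also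
sufficient for gauge equivalence on the plane (`Domino.gaugeEquivalent_of_mul_eq`).
-/

namespace Domino

/-! ### The spider move at one face -/

instance : Fintype Side := ⟨{.north, .east, .south, .west}, fun d => by cases d <;> simp⟩

/-- No two adjacent sides of the face are dimers. -/
def FaceMatching (X : Side → Bool) : Prop :=
  ((X .north || X .south) && (X .east || X .west)) = false

theorem side_funext_iff {α : Type*} (X Y : Side → α) : X = Y ↔ X .north = Y .north ∧
    X .east = Y .east ∧ X .south = Y .south ∧ X .west = Y .west := by
  constructor
  · rintro rfl
    simp
  · rintro ⟨h1, h2, h3, h4⟩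
    funext d
    cases d <;> assumption

/-- The spider move undoes itself if the mark of the second move creates the pair, if any, that
was on the face at the beginning. -/
theorem spider_spider (τ : Bool) {X : Side → Bool} (hX : FaceMatching X) :
    spider (X .north) (spider τ X) = X := by
  rw [side_funext_iff]
  simp only [FaceMatching, spider, exists_side, Side.opp] at hX ⊢
  generalize X .north = n, X .east = e, X .south = s, X .west = w at hX ⊢
  revert n e s w τ
  simp

/-- The product of the weights of the dimers on the sides of a face. -/
noncomputable def faceWeight (w : Side → ℝ) (X : Side → Bool) : ℝ := ∏ d, if X d then w d else 1

theorem faceWeight_eq (w : Side → ℝ) (X : Side → Bool) : faceWeight w X =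
    (if X .north then w .north else 1) * (if X .east then w .east else 1) *
      (if X .south then w .south else 1) * (if X .west then w .west else 1) := by
  simp [faceWeight, Finset.univ, Fintype.elems, mul_assoc]

/-- The sum of the products of opposite weights: the total weight of the two parallel pairs. -/
def pairWeight (w : Side → ℝ) : ℝ := w .north * w .south + w .east * w .west

/-- The weights after a spider move: opposite weights are exchanged and divided by the total weight
of the two parallel pairs. -/
noncomputable def spiderWeight (w : Side → ℝ) (d : Side) : ℝ := w d.opp / pairWeight w

/-- The probability of a mark, for which the spider move preserves Boltzmann weights. -/
noncomputable def markProb (w : Side → ℝ) : Bool → ℝ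
  | true => w .north * w .south / pairWeight w
  | false => w .east * w .west / pairWeight w

theorem pairWeight_pos {w : Side → ℝ} (hw : ∀ d, 0 < w d) : 0 < pairWeight w :=
  add_pos (mul_pos (hw _) (hw _)) (mul_pos (hw _) (hw _))

theorem sum_markProb {w : Side → ℝ} (hw : ∀ d, 0 < w d) : ∑ τ, markProb w τ = 1 := by
  have := (pairWeight_pos hw).ne'
  rw [Fintype.sum_bool, markProb, markProb, ← add_div]
  exact div_self this

/-- A configuration on one face, as four truth values. -/
def sideEquiv : (Side → Bool) ≃ Bool × Bool × Bool × Bool where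
  toFun X := (X .north, X .east, X .south, X .west)
  invFun b d := match d with
    | .north => b.1
    | .east => b.2.1
    | .south => b.2.2.1
    | .west => b.2.2.2
  left_inv X := by
    funext d
    cases d <;> rfl
  right_inv _ := rfl

open Classical in
/-- The spider move at one face maps Boltzmann weights to Boltzmann weights: a single dimer of
weight `w d` moves to the opposite side, the two parallel pairs merge into the empty configuration,
and the empty configuration is split between the two pairs in the ratio of their weights. -/
theorem spider_transfer {w : Side → ℝ} (hw : ∀ d, 0 < w d) {Y : Side → Bool}
    (hY : FaceMatching Y) :
    ∑ τ, markProb w τ * ∑ X : Side → Bool,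
      (if FaceMatching X ∧ spider τ X = Y then faceWeight w X else 0) =
    pairWeight w * faceWeight (spiderWeight w) Y := by
  have hp := (pairWeight_pos hw).ne'
  rw [Fintype.sum_bool, ← sideEquiv.symm.sum_comp, ← sideEquiv.symm.sum_comp]
  simp only [Fintype.sum_prod_type, Fintype.sum_bool, side_funext_iff, FaceMatching, sideEquiv,
    Equiv.coe_fn_symm_mk, spider, exists_side, Side.opp, faceWeight_eq, spiderWeight,
    markProb] at hY ⊢
  generalize Y .north = n, Y .east = e, Y .south = s, Y .west = v at hY ⊢
  cases n <;> cases e <;> cases s <;> cases v <;> simp at hY ⊢ <;> field_simp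
  all_goals simp only [pairWeight]
  all_goals ring

/-! ### Spider moves at every other face -/

section Grid

variable {R : Type} [CommRing R]

/-- The set `A` of faces consists of one of the colour classes of a chequerboard. -/
structure Alternating (A : R × R → Prop) : Prop where
  fst : ∀ f : R × R, A (f.1 + 1, f.2) ↔ ¬ A f
  snd : ∀ f : R × R, A (f.1, f.2 + 1) ↔ ¬ A f

variable {A : R × R → Prop}

theorem Alternating.not (hA : Alternating A) : Alternating fun f => ¬ A f :=
  ⟨fun f => not_congr (hA.fst f), fun f => not_congr (hA.snd f)⟩

theorem Alternating.owner_mem (hA : Alternating A) (e : Edge R) : A (owner A e).1 := by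
  rcases e with f | f <;> by_cases h : A f <;> simp [owner, h, hA.fst f, hA.snd f]

theorem faceEdge_owner (A : R × R → Prop) (e : Edge R) :
    faceEdge (owner A e).1 (owner A e).2 = e := by
  rcases e with f | f <;> by_cases h : A f <;> simp [owner, h, faceEdge]

theorem Alternating.owner_faceEdge (hA : Alternating A) {f : R × R} (hf : A f) (d : Side) :
    owner A (faceEdge f d) = (f, d) := by
  have h1 := hA.fst (f.1 - 1, f.2)
  have h2 := hA.snd (f.1, f.2 - 1)
  simp only [sub_add_cancel, Prod.mk.eta, hf, true_iff] at h1 h2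
  cases d <;> simp [owner, faceEdge, hf, h1, h2]

theorem owner_not_snd (A : R × R → Prop) (e : Edge R) :
    (owner (fun f => ¬ A f) e).2 = (owner A e).2.opp := by
  rcases e with f | f <;> by_cases h : A f <;> simp [owner, h, Side.opp]

/-- Every edge is on exactly one side of exactly one face in `A`. -/
noncomputable def Alternating.edgeEquiv (hA : Alternating A) : {f // A f} × Side ≃ Edge R where
  toFun p := faceEdge p.1.1 p.2
  invFun e := (⟨(owner A e).1, hA.owner_mem e⟩, (owner A e).2)
  left_inv p := by simp [hA.owner_faceEdge p.1.2]
  right_inv e := faceEdge_owner A e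

theorem Alternating.spiderRound_faceEdge (hA : Alternating A) (ω : R × R → Bool)
    (M : Edge R → Bool) {f : R × R} (hf : A f) (d : Side) :
    spiderRound A ω M (faceEdge f d) = spider (ω f) (fun d => M (faceEdge f d)) d := by
  rw [spiderRound, hA.owner_faceEdge hf]

theorem Alternating.ext_faceEdge (hA : Alternating A) {M M' : Edge R → Bool}
    (h : ∀ f, A f → (fun d => M (faceEdge f d)) = fun d => M' (faceEdge f d)) : M = M' := by
  funext e
  rw [← faceEdge_owner A e]
  exact congrFun (h _ (hA.owner_mem e)) _

theorem IsCovering.faceMatching {M : Edge R → Bool} (hM : IsCovering M) (f : R × R) :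
    FaceMatching fun d => M (faceEdge f d) := by
  obtain ⟨i, j⟩ := f
  have c1 := (existsUnique_side _).1 (hM (i, j))
  have c2 := (existsUnique_side _).1 (hM (i - 1, j))
  have c3 := (existsUnique_side _).1 (hM (i, j - 1))
  have c4 := (existsUnique_side _).1 (hM (i - 1, j - 1))
  simp only [vertexEdge, sub_add_cancel, FaceMatching, faceEdge] at *
  grind

/-- Spider moves at all the faces in `A` undo themselves for suitable marks. Hence the
configurations mapped to a given covering are coverings as soon as they are matchings around every
face in `A`. -/
theorem Alternating.isCovering_of_spiderRound (hA : Alternating A) {ω : R × R → Bool}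
    {M : Edge R → Bool} (hM : ∀ f, A f → FaceMatching fun d => M (faceEdge f d))
    (h : IsCovering (spiderRound A ω M)) : IsCovering M := by
  have key : spiderRound A (fun f => M (faceEdge f .north)) (spiderRound A ω M) = M := by
    refine hA.ext_faceEdge fun f hf => ?_
    funext d
    rw [hA.spiderRound_faceEdge _ _ hf]
    simp only [hA.spiderRound_faceEdge _ _ hf]
    exact congrFun (spider_spider (ω f) (hM f hf)) d
  rw [← key]
  exact spiderRound_isCovering hA.fst hA.snd _ h

theorem Alternating.isCovering_and_spiderRound_eq_iff (hA : Alternating A) {ω : R × R → Bool}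
    {M Y : Edge R → Bool} (hY : IsCovering Y) :
    IsCovering M ∧ spiderRound A ω M = Y ↔ ∀ f : {f // A f},
      FaceMatching (fun d => M (faceEdge f.1 d)) ∧
        spider (ω f.1) (fun d => M (faceEdge f.1 d)) = fun d => Y (faceEdge f.1 d) := by
  constructor
  · rintro ⟨hM, rfl⟩ f
    refine ⟨hM.faceMatching _, ?_⟩
    funext d
    rw [hA.spiderRound_faceEdge _ _ f.2]
  · intro h
    have hr : spiderRound A ω M = Y := hA.ext_faceEdge fun f hf => by
      simp only [hA.spiderRound_faceEdge _ _ hf]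
      exact (h ⟨f, hf⟩).2
    exact ⟨hA.isCovering_of_spiderRound (fun f hf => (h ⟨f, hf⟩).1) (hr ▸ hY), hr⟩

variable [Fintype R]

/-- The Boltzmann weight of a set of edges, where the weight of an edge depends only on which side
of a face in `A` it is. -/
noncomputable def configWeight (A : R × R → Prop) (w : Side → ℝ) (M : Edge R → Bool) : ℝ :=
  ∏ e, if M e then w (owner A e).2 else 1

theorem configWeight_not (A : R × R → Prop) (w : Side → ℝ) (M : Edge R → Bool) :
    configWeight (fun f => ¬ A f) w M = configWeight A (fun d => w d.opp) M := by
  simp only [configWeight, owner_not_snd]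

open Classical in
theorem Alternating.configWeight_eq_prod (hA : Alternating A) (w : Side → ℝ) (M : Edge R → Bool) :
    configWeight A w M = ∏ f : {f // A f}, faceWeight w fun d => M (faceEdge f.1 d) := by
  rw [configWeight, ← hA.edgeEquiv.prod_comp, Fintype.prod_prod_type]
  refine Finset.prod_congr rfl fun f _ => Finset.prod_congr rfl fun d _ => ?_
  simp only [edgeEquiv, Equiv.coe_fn_mk, hA.owner_faceEdge f.2]

/-- The probability of the marks `ω`, if they are independent with law `p`. -/
def markWeight {ι : Type*} [Fintype ι] (p : Bool → ℝ) (ω : ι → Bool) : ℝ := ∏ f, p (ω f)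

variable [DecidableEq R]

open Classical in
/-- For fixed marks, the weights of the coverings that are mapped to `Y` factorize over the
faces. -/
theorem Alternating.sum_fiber (hA : Alternating A) (w : Side → ℝ) (ω : R × R → Bool)
    {Y : Edge R → Bool} (hY : IsCovering Y) :
    ∑ M : Edge R → Bool,
      (if IsCovering M ∧ spiderRound A ω M = Y then configWeight A w M else 0) =
    ∏ f : {f // A f}, ∑ X : Side → Bool,
      if FaceMatching X ∧ spider (ω f.1) X = (fun d => Y (faceEdge f.1 d)) then
        faceWeight w X else 0 := by
  rw [Finset.prod_univ_sum, Fintype.piFinset_univ,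
    ← ((hA.edgeEquiv.symm.arrowCongr (Equiv.refl Bool)).trans
      (Equiv.curry _ _ _)).sum_comp]
  refine Finset.sum_congr rfl fun M _ => ?_
  have hM : ∀ f : {f // A f}, ((hA.edgeEquiv.symm.arrowCongr (Equiv.refl Bool)).trans
      (Equiv.curry _ _ _)) M f = fun d => M (faceEdge f.1 d) := fun f => rfl
  simp only [hM, hA.isCovering_and_spiderRound_eq_iff hY, hA.configWeight_eq_prod]
  rw [Finset.prod_ite_zero]
  simp

open Classical in
theorem prod_ite_one_eq_prod_subtype {ι : Type*} [Fintype ι] (p : ι → Prop) (g : ι → ℝ) :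
    ∏ i, (if p i then g i else 1) = ∏ i : {i // p i}, g i := by
  rw [← Finset.prod_filter]
  exact Finset.prod_subtype _ (by simp) g

open Classical in
/-- A round of spider moves maps Boltzmann weights to Boltzmann weights, up to a constant. -/
theorem Alternating.spiderRound_transfer (hA : Alternating A) {w : Side → ℝ} (hw : ∀ d, 0 < w d)
    {Y : Edge R → Bool} (hY : IsCovering Y) :
    ∑ ω : R × R → Bool, markWeight (markProb w) ω * ∑ M : Edge R → Bool,
      (if IsCovering M ∧ spiderRound A ω M = Y then configWeight A w M else 0) =
    pairWeight w ^ Nat.card {f // A f} * configWeight A (spiderWeight w) Y := by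
  let k (f : R × R) (τ : Bool) : ℝ := ∑ X : Side → Bool,
    if FaceMatching X ∧ spider τ X = (fun d => Y (faceEdge f d)) then faceWeight w X else 0
  have h1 (ω : R × R → Bool) : markWeight (markProb w) ω * ∑ M : Edge R → Bool,
      (if IsCovering M ∧ spiderRound A ω M = Y then configWeight A w M else 0) =
      ∏ f, markProb w (ω f) * if A f then k f (ω f) else 1 := by
    rw [hA.sum_fiber w ω hY, Finset.prod_mul_distrib, markWeight,
      prod_ite_one_eq_prod_subtype A]
  simp only [h1]
  rw [← Fintype.piFinset_univ, ← Finset.prod_univ_sum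
    (f := fun f τ => markProb w τ * if A f then k f τ else 1)]
  have h2 (f : R × R) : ∑ τ, markProb w τ * (if A f then k f τ else 1) =
      if A f then pairWeight w * faceWeight (spiderWeight w) (fun d => Y (faceEdge f d))
      else 1 := by
    split_ifs
    · exact spider_transfer hw (hY.faceMatching f)
    · simpa using sum_markProb hw
  simp only [h2]
  rw [hA.configWeight_eq_prod, prod_ite_one_eq_prod_subtype A
    (fun f => pairWeight w * faceWeight (spiderWeight w) fun d => Y (faceEdge f d)),
    Finset.prod_mul_distrib, Finset.prod_const, Finset.card_univ, Nat.card_eq_fintype_card]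

end Grid

/-! ### Independence of the marks of the two rounds -/

section Marks

variable {ι : Type*} [Fintype ι] [DecidableEq ι] {p : Bool → ℝ}

theorem sum_markWeight (hp : ∑ τ, p τ = 1) : ∑ ω : ι → Bool, markWeight p ω = 1 := by
  simp only [markWeight]
  rw [← Fintype.piFinset_univ, ← Finset.prod_univ_sum (f := fun _ τ => p τ)]
  rw [hp, Finset.prod_const_one]

open Classical in
theorem sum_markWeight_mul (hp : ∑ τ, p τ = 1) (q : ι → Prop) {F G : (ι → Bool) → ℝ}
    (hF : ∀ ω ω', (∀ i, q i → ω i = ω' i) → F ω = F ω')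
    (hG : ∀ ω ω', (∀ i, ¬ q i → ω i = ω' i) → G ω = G ω') :
    ∑ ω, markWeight p ω * (F ω * G ω) =
      (∑ ω, markWeight p ω * F ω) * ∑ ω, markWeight p ω * G ω := by
  let e := Equiv.piEquivPiSubtypeProd q fun _ => Bool
  have he (x) (b) : markWeight p (e.symm (x, b)) = markWeight p x * markWeight p b := by
    simp only [markWeight, e]
    rw [← Fintype.prod_subtype_mul_prod_subtype q]
    congr 1
    · exact Finset.prod_congr rfl fun i _ => by simp [Equiv.piEquivPiSubtypeProd, i.2]
    · exact Finset.prod_congr rfl fun i _ => by simp [Equiv.piEquivPiSubtypeProd, i.2]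
  have hF' (x) (b) : F (e.symm (x, b)) = F (e.symm (x, fun _ => true)) :=
    hF _ _ fun i hi => by simp [e, Equiv.piEquivPiSubtypeProd, hi]
  have hG' (x) (b) : G (e.symm (x, b)) = G (e.symm (fun _ => true, b)) :=
    hG _ _ fun i hi => by simp [e, Equiv.piEquivPiSubtypeProd, hi]
  have h1 : ∑ ω, markWeight p ω * F ω = ∑ x, markWeight p x * F (e.symm (x, fun _ => true)) := by
    rw [← e.symm.sum_comp, Fintype.sum_prod_type]
    refine Finset.sum_congr rfl fun x _ => ?_
    simp only [he, hF' x]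
    rw [← Finset.sum_mul, ← Finset.mul_sum, sum_markWeight hp, mul_one]
  have h2 : ∑ ω, markWeight p ω * G ω = ∑ b, markWeight p b * G (e.symm (fun _ => true, b)) := by
    rw [← e.symm.sum_comp, Fintype.sum_prod_type, Finset.sum_comm]
    refine Finset.sum_congr rfl fun b _ => ?_
    simp only [he, hG' _ b]
    rw [← Finset.sum_mul, ← Finset.sum_mul, sum_markWeight hp, one_mul]
  rw [h1, h2, Finset.sum_mul_sum, ← e.symm.sum_comp, Fintype.sum_prod_type]
  refine Finset.sum_congr rfl fun x _ => Finset.sum_congr rfl fun b _ => ?_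
  rw [he, hF' x b, hG' x b]
  ring

end Marks

/-! ### The shuffle of a finite grid -/

section Grid

variable {R : Type} [CommRing R]

theorem Alternating.spiderRound_congr {A : R × R → Prop} (hA : Alternating A)
    {ω ω' : R × R → Bool} (h : ∀ f, A f → ω f = ω' f) (M : Edge R → Bool) :
    spiderRound A ω M = spiderRound A ω' M := by
  funext e
  rw [spiderRound, spiderRound, h _ (hA.owner_mem e)]

/-- One domino shuffle of a set of edges: a round of spider moves at the even faces and one at the
odd faces. -/
noncomputable def shuffleConfig (ω : R × R → Bool) (M : Edge R → Bool) : Edge R → Bool :=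
  spiderRound (fun f => ¬ IsEvenFace f) ω (spiderRound IsEvenFace ω M)

theorem isCovering_shuffleConfig (hE : Alternating (IsEvenFace (R := R))) (ω : R × R → Bool)
    {M : Edge R → Bool} (hM : IsCovering M) : IsCovering (shuffleConfig ω M) :=
  spiderRound_isCovering hE.not.fst hE.not.snd ω (spiderRound_isCovering hE.fst hE.snd ω hM)

theorem Side.opp_opp (d : Side) : d.opp.opp = d := by cases d <;> rfl

variable [Fintype R] [DecidableEq R]

open Classical in
/-- A shuffle maps Boltzmann weights to Boltzmann weights for the same edge weights, up to a
constant. After the first round the edges on the four sides of the odd faces have, up to a constant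
factor, the weights of the corresponding sides of the even faces before; so the second round, with
the same law of the marks, restores the original weights. -/
theorem shuffleConfig_transfer (hE : Alternating (IsEvenFace (R := R))) {w : Side → ℝ}
    (hw : ∀ d, 0 < w d) : ∃ c : ℝ, ∀ Y : Edge R → Bool, IsCovering Y →
    ∑ ω : R × R → Bool, markWeight (markProb w) ω * ∑ M : Edge R → Bool,
      (if IsCovering M ∧ shuffleConfig ω M = Y then configWeight IsEvenFace w M else 0) =
    c * configWeight IsEvenFace w Y := by
  have hp := pairWeight_pos hw
  have hs := sum_markProb hw
  -- the weights on the sides of the odd faces between the two rounds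
  let v : Side → ℝ := fun d => spiderWeight w d.opp
  have hv (d : Side) : v d = w d / pairWeight w := by simp only [v, spiderWeight, Side.opp_opp]
  have hv0 (d : Side) : 0 < v d := by
    rw [hv]
    exact div_pos (hw d) hp
  have hvp : pairWeight v = 1 / pairWeight w := by
    rw [pairWeight, hv, hv, hv, hv, div_mul_div_comm, div_mul_div_comm, ← add_div]
    rw [show w .north * w .south + w .east * w .west = pairWeight w from rfl]
    field_simp
  have hvm : markProb v = markProb w := by
    funext τ
    cases τ <;> simp only [markProb, hvp, hv] <;> field_simp
  have hvs : spiderWeight v = fun d => w d.opp := by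
    funext d
    rw [spiderWeight, hvp, hv]
    field_simp
  have hmid (M : Edge R → Bool) : configWeight IsEvenFace (spiderWeight w) M =
      configWeight (fun f => ¬ IsEvenFace f) v M := by
    rw [configWeight_not]
    simp only [v, Side.opp_opp]
  refine ⟨pairWeight w ^ Nat.card {f : R × R // IsEvenFace f} *
    pairWeight v ^ Nat.card {f : R × R // ¬ IsEvenFace f}, fun Y hY => ?_⟩
  let F (M' : Edge R → Bool) (ω : R × R → Bool) : ℝ := ∑ M : Edge R → Bool,
    if IsCovering M ∧ spiderRound IsEvenFace ω M = M' then configWeight IsEvenFace w M else 0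
  let G (M' : Edge R → Bool) (ω : R × R → Bool) : ℝ :=
    if IsCovering M' ∧ spiderRound (fun f => ¬ IsEvenFace f) ω M' = Y then 1 else 0
  have hsplit (ω : R × R → Bool) : ∑ M : Edge R → Bool,
      (if IsCovering M ∧ shuffleConfig ω M = Y then configWeight IsEvenFace w M else 0) =
      ∑ M', F M' ω * G M' ω := by
    simp only [F, Finset.sum_mul]
    rw [Finset.sum_comm]
    refine Finset.sum_congr rfl fun M _ => ?_
    rw [Finset.sum_eq_single (spiderRound IsEvenFace ω M)]
    · by_cases hM : IsCovering M
      · have := spiderRound_isCovering hE.fst hE.snd ω hM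
        simp [G, hM, this, shuffleConfig]
      · simp [hM]
    · intro M' _ hne
      simp [hne.symm]
    · simp
  simp only [hsplit, Finset.mul_sum]
  rw [Finset.sum_comm]
  have hstep (M' : Edge R → Bool) : ∑ ω, markWeight (markProb w) ω * (F M' ω * G M' ω) =
      pairWeight w ^ Nat.card {f : R × R // IsEvenFace f} *
        ∑ ω, markWeight (markProb v) ω *
          (if IsCovering M' ∧ spiderRound (fun f => ¬ IsEvenFace f) ω M' = Y then
            configWeight (fun f => ¬ IsEvenFace f) v M' else 0) := by
    by_cases hM' : IsCovering M'
    · rw [sum_markWeight_mul hs IsEvenFace, hE.spiderRound_transfer hw hM', hmid, hvm, mul_assoc,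
        Finset.mul_sum]
      · congr 1
        refine Finset.sum_congr rfl fun ω _ => ?_
        simp only [G]
        split_ifs <;> ring
      · intro ω ω' h
        simp only [F, hE.spiderRound_congr h]
      · intro ω ω' h
        simp only [G, hE.not.spiderRound_congr h]
    · simp [G, hM']
  simp only [hstep]
  rw [← Finset.mul_sum, Finset.sum_comm]
  simp only [← Finset.mul_sum]
  rw [hE.not.spiderRound_transfer hv0 hY, hvs, configWeight_not]
  simp only [Side.opp_opp]
  rw [mul_assoc]

end Grid

/-! ### The shuffle of a torus -/

theorem alternating_zmod (n : ℕ) : Alternating (IsEvenFace (R := ZMod (2 * n))) := by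
  constructor <;> intro f
  all_goals
    rw [isEvenFace_zmod, isEvenFace_zmod]
    simp only [map_add, map_one]
    generalize ZMod.castHom _ (ZMod 2) f.1 = x, ZMod.castHom _ (ZMod 2) f.2 = y
    revert x y
    decide

/-- One domino shuffle of a dimer covering of the torus. -/
noncomputable def torusShuffle {n : ℕ} (M : DimerCovering (ZMod (2 * n)))
    (ω : ZMod (2 * n) × ZMod (2 * n) → Bool) : DimerCovering (ZMod (2 * n)) :=
  ⟨shuffleConfig ω M.1, isCovering_shuffleConfig (alternating_zmod n) ω M.2⟩

variable (n : ℕ+) {w : Side → ℝ}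

theorem coveringWeight_eq_configWeight (M : DimerCovering (ZMod (2 * (n : ℕ)))) :
    coveringWeight n w M = configWeight IsEvenFace w M.1 := by
  rw [coveringWeight, configWeight, Finset.prod_filter]
  rfl

open Classical in
theorem torusShuffle_transfer (hw : ∀ d, 0 < w d) (Y : DimerCovering (ZMod (2 * (n : ℕ)))) :
    ∑ ω, markWeight (markProb w) ω * ∑ M : DimerCovering (ZMod (2 * (n : ℕ))),
      (if torusShuffle M ω = Y then coveringWeight n w M else 0) = coveringWeight n w Y := by
  obtain ⟨c, hc⟩ := shuffleConfig_transfer (alternating_zmod n) hw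
  have key (Y : DimerCovering (ZMod (2 * (n : ℕ)))) :
      ∑ ω, markWeight (markProb w) ω * ∑ M : DimerCovering (ZMod (2 * (n : ℕ))),
        (if torusShuffle M ω = Y then coveringWeight n w M else 0) = c * coveringWeight n w Y := by
    rw [coveringWeight_eq_configWeight, ← hc Y.1 Y.2]
    refine Finset.sum_congr rfl fun ω _ => ?_
    simp only [ite_and]
    rw [← Finset.sum_filter (p := fun M => IsCovering M),
      Finset.sum_subtype (p := IsCovering) _ (by simp)]
    simp only [coveringWeight_eq_configWeight, Subtype.ext_iff]
    rfl
  -- the constant is one because both sides have the same total mass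
  have hZ := partitionFunction_pos n hw
  have htot : partitionFunction n w = c * partitionFunction n w := by
    conv_rhs => rw [partitionFunction, Finset.mul_sum]
    simp only [← key]
    rw [Finset.sum_comm]
    simp only [← Finset.mul_sum]
    have this (ω) : ∑ Y, ∑ M : DimerCovering (ZMod (2 * (n : ℕ))),
        (if torusShuffle M ω = Y then coveringWeight n w M else 0) = partitionFunction n w := by
      rw [Finset.sum_comm]
      simp [partitionFunction]
    simp only [this]
    rw [← Finset.sum_mul, sum_markWeight (sum_markProb hw), one_mul]
  have hc1 : c = 1 := by
    field_simp at htot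
    exact htot.symm
  rw [key, hc1, one_mul]

/-! ### From the torus to the plane -/

section Lift

variable (n : ℕ+)

/-- The projection of the faces of the plane to the faces of the torus. -/
def projFace (f : ℤ × ℤ) : ZMod (2 * (n : ℕ)) × ZMod (2 * (n : ℕ)) := (f.1, f.2)

/-- The representatives of the faces of the torus in a fundamental domain centred at the origin. -/
def sectionFace (t : ZMod (2 * (n : ℕ)) × ZMod (2 * (n : ℕ))) : ℤ × ℤ :=
  (t.1.valMinAbs, t.2.valMinAbs)

theorem projFace_sectionFace (t : ZMod (2 * (n : ℕ)) × ZMod (2 * (n : ℕ))) :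
    projFace n (sectionFace n t) = t := by
  simp [projFace, sectionFace]

theorem sectionFace_injective : Function.Injective (sectionFace n) :=
  Function.LeftInverse.injective (projFace_sectionFace n)

theorem sectionFace_projFace {f : ℤ × ℤ} (h1 : |f.1| < n) (h2 : |f.2| < n) :
    sectionFace n (projFace n f) = f := by
  rw [abs_lt] at h1 h2
  ext
  · refine (ZMod.valMinAbs_spec _ _).2 ⟨rfl, ?_⟩
    push_cast
    constructor <;> lia
  · refine (ZMod.valMinAbs_spec _ _).2 ⟨rfl, ?_⟩
    push_cast
    constructor <;> lia

theorem isEvenFace_projFace (f : ℤ × ℤ) : IsEvenFace (projFace n f) ↔ IsEvenFace f := by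
  rw [isEvenFace_zmod, projFace, ← Int.cast_add, map_intCast, ZMod.intCast_zmod_eq_zero_iff_dvd,
    IsEvenFace, even_iff_two_dvd]
  rfl

theorem projEdge_faceEdge (f : ℤ × ℤ) (d : Side) :
    projEdge n (faceEdge f d) = faceEdge (projFace n f) d := by
  cases d <;> simp [projEdge, faceEdge, projFace]

theorem owner_projEdge {A : ℤ × ℤ → Prop}
    {A' : ZMod (2 * (n : ℕ)) × ZMod (2 * (n : ℕ)) → Prop} (h : ∀ f, A' (projFace n f) ↔ A f)
    (e : Edge ℤ) : owner A' (projEdge n e) = (projFace n (owner A e).1, (owner A e).2) := by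
  rcases e with f | f
  all_goals
    have hf : A' ((f.1 : ZMod (2 * (n : ℕ))), (f.2 : ZMod (2 * (n : ℕ)))) ↔ A f := h f
    by_cases hA : A f <;> simp [owner, projEdge, hf, hA, projFace]

theorem spiderRound_projEdge {A : ℤ × ℤ → Prop}
    {A' : ZMod (2 * (n : ℕ)) × ZMod (2 * (n : ℕ)) → Prop} (h : ∀ f, A' (projFace n f) ↔ A f)
    (ω : ZMod (2 * (n : ℕ)) × ZMod (2 * (n : ℕ)) → Bool)
    (M : Edge (ZMod (2 * (n : ℕ))) → Bool) (e : Edge ℤ) :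
    spiderRound A' ω M (projEdge n e) =
      spiderRound A (fun f => ω (projFace n f)) (fun e => M (projEdge n e)) e := by
  simp only [spiderRound, owner_projEdge n h, projEdge_faceEdge]

/-- Shuffling commutes with lifting, if the plane carries periodic marks. -/
theorem lift_torusShuffle (M : DimerCovering (ZMod (2 * (n : ℕ))))
    (ω : ZMod (2 * (n : ℕ)) × ZMod (2 * (n : ℕ)) → Bool) :
    lift n (torusShuffle M ω) = shuffle (lift n M) fun f => ω (projFace n f) := by
  apply Subtype.ext
  funext e
  simp only [lift, torusShuffle, shuffleConfig, shuffle]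
  rw [spiderRound_projEdge n (fun f => not_congr (isEvenFace_projFace n f))]
  congr 1
  funext e
  rw [spiderRound_projEdge n (isEvenFace_projFace n)]

end Lift

/-- The faces whose marks have an influence on an edge after one shuffle. -/
noncomputable def markWindow (e : Edge ℤ) : Finset (ℤ × ℤ) :=
  insert (owner (fun f => ¬ IsEvenFace f) e).1 (Finset.univ.image fun d =>
    (owner IsEvenFace (faceEdge (owner (fun f => ¬ IsEvenFace f) e).1 d)).1)

theorem shuffle_congr (M : DimerCovering ℤ) {ω ω' : ℤ × ℤ → Bool} {e : Edge ℤ}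
    (h : ∀ f ∈ markWindow e, ω f = ω' f) : (shuffle M ω).1 e = (shuffle M ω').1 e := by
  simp only [shuffle, spiderRound]
  rw [h _ (Finset.mem_insert_self _ _)]
  congr 1
  funext d
  rw [h _ (Finset.mem_insert_of_mem (Finset.mem_image_of_mem _ (Finset.mem_univ d)))]

instance : SecondCountableTopology (DimerCovering ℤ) :=
  TopologicalSpace.Subtype.secondCountableTopology _

instance : TopologicalSpace.MetrizableSpace (DimerCovering ℤ) :=
  Topology.IsEmbedding.subtypeVal.metrizableSpace

theorem continuous_spiderRound (A : ℤ × ℤ → Prop) :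
    Continuous fun p : (Edge ℤ → Bool) × (ℤ × ℤ → Bool) => spiderRound A p.2 p.1 := by
  refine continuous_pi fun e => ?_
  have h : Continuous fun q : Bool × (Side → Bool) => spider q.1 q.2 (owner A e).2 :=
    continuous_of_discreteTopology
  exact h.comp (f := fun p : (Edge ℤ → Bool) × (ℤ × ℤ → Bool) =>
    (p.2 (owner A e).1, fun d => p.1 (faceEdge (owner A e).1 d))) (by fun_prop)

theorem continuous_shuffle :
    Continuous fun p : DimerCovering ℤ × (ℤ × ℤ → Bool) => shuffle p.1 p.2 := by
  refine Continuous.subtype_mk ?_ _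
  have h := (continuous_spiderRound IsEvenFace).comp (f :=
    fun p : DimerCovering ℤ × (ℤ × ℤ → Bool) => (p.1.1, p.2)) (by fun_prop)
  exact (continuous_spiderRound fun f => ¬ IsEvenFace f).comp (h.prodMk continuous_snd)

instance (a : ℝ) (ha : 0 < a) : IsProbabilityMeasure (markMeasure a ha) := by
  rw [markMeasure]
  infer_instance

/-- For gauge-modified weights, the marks of the shuffle have the law that preserves Boltzmann
weights. -/
theorem markProb_eq {a : ℝ} (ha : 0 < a) {w : Side → ℝ} (hw : ∀ d, 0 < w d)
    (h : a * (w .north * w .south) = w .east * w .west) :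
    markProb w true = 1 / (1 + a) ∧ markProb w false = 1 - 1 / (1 + a) := by
  have h1 := hw .north
  have h2 := hw .south
  simp only [markProb, pairWeight, ← h]
  constructor <;> field_simp
  ring

/-- The marks on a fundamental domain are independent marks on the torus. -/
theorem markMeasure_restrict (n : ℕ+) {a : ℝ} (ha : 0 < a) {w : Side → ℝ} (hw : ∀ d, 0 < w d)
    (h : a * (w .north * w .south) = w .east * w .west)
    (τ : ZMod (2 * (n : ℕ)) × ZMod (2 * (n : ℕ)) → Bool) :
    (markMeasure a ha).map (fun ω t => ω (sectionFace n t)) {τ} =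
      ENNReal.ofReal (markWeight (markProb w) τ) := by
  obtain ⟨m1, m2⟩ := markProb_eq ha hw h
  have hset : (fun (ω : ℤ × ℤ → Bool) t => ω (sectionFace n t)) ⁻¹' {τ} =
      Set.pi (Finset.univ.map ⟨sectionFace n, sectionFace_injective n⟩ : Finset (ℤ × ℤ))
        fun f => {τ (projFace n f)} := by
    ext ω
    simp only [Set.mem_preimage, Set.mem_singleton_iff, funext_iff, Set.mem_pi, Finset.coe_map,
      Finset.coe_univ, Set.image_univ, Set.forall_mem_range, Function.Embedding.coeFn_mk,
      projFace_sectionFace]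
  rw [Measure.map_apply (by fun_prop) (measurableSet_singleton _), hset, markMeasure,
    Measure.infinitePi_pi _ (fun _ _ => measurableSet_singleton _), Finset.prod_map, markWeight,
    ENNReal.ofReal_prod_of_nonneg]
  · refine Finset.prod_congr rfl fun t _ => ?_
    simp only [Function.Embedding.coeFn_mk, projFace_sectionFace]
    rw [← ofReal_measureReal, bernoulliMeasure_real_apply _ (measurableSet_singleton _)]
    cases τ t <;> simp [m1, m2]
  · intro t _
    have h1 : 1 / (1 + a) ≤ 1 := (div_le_one (by positivity)).2 (by linarith)
    cases τ t
    · rw [m2]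
      linarith
    · rw [m1]
      positivity

open Classical in
/-- The Boltzmann measure on the torus is invariant under the shuffle with independent marks. -/
theorem boltzmann_prod_map_torusShuffle (n : ℕ+) {a : ℝ} (ha : 0 < a) {w : Side → ℝ}
    (hw : ∀ d, 0 < w d) (h : a * (w .north * w .south) = w .east * w .west) :
    ((boltzmann n hw).toMeasure.prod (markMeasure a ha)).map
      (fun p => torusShuffle p.1 fun t => p.2 (sectionFace n t)) = (boltzmann n hw).toMeasure := by
  have hZ := partitionFunction_pos n hw
  have hsec : Measurable fun (ω : ℤ × ℤ → Bool) t => ω (sectionFace n t) := by fun_prop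
  have hmap : ((boltzmann n hw).toMeasure.prod (markMeasure a ha)).map
      (fun p => torusShuffle p.1 fun t => p.2 (sectionFace n t)) =
      ((boltzmann n hw).toMeasure.prod ((markMeasure a ha).map
        fun ω t => ω (sectionFace n t))).map fun p => torusShuffle p.1 p.2 := by
    have := Measure.map_prod_map (boltzmann n hw).toMeasure (markMeasure a ha) measurable_id hsec
    rw [Measure.map_id] at this
    rw [this, Measure.map_map .of_discrete (by fun_prop)]
    rfl
  rw [hmap]
  refine Measure.ext_of_singleton ?_
  intro Y
  have hmw (ω : ZMod (2 * (n : ℕ)) × ZMod (2 * (n : ℕ)) → Bool) :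
      0 ≤ markWeight (markProb w) ω := Finset.prod_nonneg fun f _ => by
    cases ω f <;>
      exact div_nonneg (mul_nonneg (hw _).le (hw _).le) (pairWeight_pos hw).le
  let T := (Finset.univ : Finset (DimerCovering (ZMod (2 * (n : ℕ))) ×
    (ZMod (2 * (n : ℕ)) × ZMod (2 * (n : ℕ)) → Bool))).filter fun p => torusShuffle p.1 p.2 = Y
  have hT : (fun p : DimerCovering (ZMod (2 * (n : ℕ))) ×
      (ZMod (2 * (n : ℕ)) × ZMod (2 * (n : ℕ)) → Bool) => torusShuffle p.1 p.2) ⁻¹' {Y} = T := by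
    ext p
    simp [T]
  have hpt (p : DimerCovering (ZMod (2 * (n : ℕ))) ×
      (ZMod (2 * (n : ℕ)) × ZMod (2 * (n : ℕ)) → Bool)) :
      ((boltzmann n hw).toMeasure.prod ((markMeasure a ha).map
        fun ω t => ω (sectionFace n t))) {p} = ENNReal.ofReal
        (coveringWeight n w p.1 / partitionFunction n w * markWeight (markProb w) p.2) := by
    rw [← Set.singleton_prod_singleton, Measure.prod_prod,
      PMF.toMeasure_apply_singleton _ _ (measurableSet_singleton _),
      markMeasure_restrict n ha hw h,
      ENNReal.ofReal_mul (div_nonneg (coveringWeight_pos n hw _).le hZ.le)]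
    rfl
  rw [Measure.map_apply .of_discrete (measurableSet_singleton _), hT, ← sum_measure_singleton,
    PMF.toMeasure_apply_singleton _ _ (measurableSet_singleton _)]
  simp only [hpt]
  rw [← ENNReal.ofReal_sum_of_nonneg fun p _ => mul_nonneg
    (div_nonneg (coveringWeight_pos n hw _).le hZ.le) (hmw _)]
  change _ = ENNReal.ofReal (coveringWeight n w Y / partitionFunction n w)
  rw [← torusShuffle_transfer n hw Y, Finset.sum_filter, Fintype.sum_prod_type, Finset.sum_comm,
    Finset.sum_div]
  congr 1
  refine Finset.sum_congr rfl fun ω _ => ?_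
  rw [Finset.mul_sum, Finset.sum_div]
  refine Finset.sum_congr rfl fun M _ => ?_
  split_ifs <;> ring

theorem continuous_restrict_window (E : Finset (Edge ℤ)) :
    Continuous fun (M : DimerCovering ℤ) (e : E) => M.1 e :=
  continuous_pi fun e => (continuous_apply e.1).comp continuous_subtype_val

/-- On a finite window the law of a shuffled periodic covering is the original one, if the torus is
large. -/
theorem boltzmannPlane_shuffle (n : ℕ+) {a : ℝ} (ha : 0 < a) {w : Side → ℝ} (hw : ∀ d, 0 < w d)
    (h : a * (w .north * w .south) = w .east * w .west) (E : Finset (Edge ℤ))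
    (hE : ∀ e ∈ E, ∀ f ∈ markWindow e, sectionFace n (projFace n f) = f) (S : Set (E → Bool)) :
    ((boltzmannPlane n hw : Measure (DimerCovering ℤ)).prod (markMeasure a ha)).map
      (fun p => shuffle p.1 p.2) {M | (fun e : E => M.1 e) ∈ S} =
    (boltzmannPlane n hw : Measure (DimerCovering ℤ)) {M | (fun e : E => M.1 e) ∈ S} := by
  have hC : MeasurableSet {M : DimerCovering ℤ | (fun e : E => M.1 e) ∈ S} :=
    (continuous_restrict_window E).measurable (.of_discrete (s := S))
  have hlift : Measurable (lift n) := .of_discrete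
  have hB : (boltzmannPlane n hw : Measure (DimerCovering ℤ)) =
      (boltzmann n hw).toMeasure.map (lift n) := (PMF.toMeasure_map _ _ hlift).symm
  have hprod := Measure.map_prod_map (boltzmann n hw).toMeasure (markMeasure a ha) hlift
    measurable_id
  rw [Measure.map_id] at hprod
  have hts : Measurable fun p : DimerCovering (ZMod (2 * (n : ℕ))) × (ℤ × ℤ → Bool) =>
      torusShuffle p.1 fun t => p.2 (sectionFace n t) := by
    refine Measurable.comp (g := fun p : DimerCovering (ZMod (2 * (n : ℕ))) ×
      (ZMod (2 * (n : ℕ)) × ZMod (2 * (n : ℕ)) → Bool) => torusShuffle p.1 p.2)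
      (f := fun p : DimerCovering (ZMod (2 * (n : ℕ))) × (ℤ × ℤ → Bool) =>
        (p.1, fun t => p.2 (sectionFace n t))) .of_discrete (by fun_prop)
  rw [hB, hprod, Measure.map_map continuous_shuffle.measurable (hlift.prodMap measurable_id),
    Measure.map_apply (continuous_shuffle.measurable.comp (hlift.prodMap measurable_id)) hC]
  conv_rhs => rw [← boltzmann_prod_map_torusShuffle n ha hw h, Measure.map_map hlift hts,
    Measure.map_apply (hlift.comp hts) hC]
  congr 1
  ext ⟨M, ω⟩
  have key : (fun e : E => (shuffle (lift n M) ω).1 e) =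
      fun e : E => (lift n (torusShuffle M fun t => ω (sectionFace n t))).1 e := by
    funext e
    rw [lift_torusShuffle]
    exact shuffle_congr _ fun f hf => by rw [hE e e.2 f hf]
  simp only [Set.mem_preimage, Function.comp_apply, Prod.map_apply, id_eq, Set.mem_ofPred_eq, key]

/-! ### The limit -/

/-- A measure on dimer coverings of the plane is determined by its values on the events that depend
on finitely many edges. -/
theorem measure_ext_of_finite_window {μ ν : Measure (DimerCovering ℤ)} [IsFiniteMeasure μ]
    [IsFiniteMeasure ν] (h : ∀ (E : Finset (Edge ℤ)) (S : Set (E → Bool)),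
      μ {M | (fun e : E => M.1 e) ∈ S} = ν {M | (fun e : E => M.1 e) ∈ S}) : μ = ν := by
  have hval : Measurable (Subtype.val : DimerCovering ℤ → Edge ℤ → Bool) := measurable_subtype_coe
  have key : μ.map Subtype.val = ν.map Subtype.val := by
    refine IsProjectiveLimit.unique (P := fun E => (μ.map Subtype.val).map E.restrict)
      (fun E => rfl) fun E => ?_
    ext S hS
    rw [Measure.map_apply (by fun_prop) hS, Measure.map_apply (by fun_prop) hS,
      Measure.map_apply hval (E.measurable_restrict hS),
      Measure.map_apply hval (E.measurable_restrict hS)]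
    exact (h E S).symm
  ext s hs
  obtain ⟨t, ht, rfl⟩ := hs
  rw [← Measure.map_apply hval ht, key, Measure.map_apply hval ht]

theorem shuffleInvariant_of_tendsto {a : ℝ} (ha : 0 < a) {w : Side → ℝ} (hw : ∀ d, 0 < w d)
    (h : a * (w .north * w .south) = w .east * w .west) {n : ℕ → ℕ+} (hn : StrictMono n)
    {π : ProbabilityMeasure (DimerCovering ℤ)}
    (hπ : Tendsto (fun k => boltzmannPlane (n k) hw) atTop (𝓝 π)) : ShuffleInvariant a ha π := by
  let ν : ProbabilityMeasure (ℤ × ℤ → Bool) := ⟨markMeasure a ha, inferInstance⟩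
  have hlim : Tendsto (fun k => ((boltzmannPlane (n k) hw).prod ν).map
      continuous_shuffle.measurable.aemeasurable) atTop
      (𝓝 ((π.prod ν).map continuous_shuffle.measurable.aemeasurable)) :=
    ProbabilityMeasure.tendsto_map_of_tendsto_of_continuous _ _
      ((ProbabilityMeasure.continuous_prod.tendsto (π, ν)).comp (hπ.prodMk_nhds tendsto_const_nhds))
      continuous_shuffle
  have hfin : IsProbabilityMeasure (((π : Measure (DimerCovering ℤ)).prod (markMeasure a ha)).map
      fun p => shuffle p.1 p.2) :=
    Measure.isProbabilityMeasure_map continuous_shuffle.measurable.aemeasurable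
  refine measure_ext_of_finite_window fun E S => ?_
  have hC : IsClopen {M : DimerCovering ℤ | (fun e : E => M.1 e) ∈ S} :=
    (isClopen_discrete S).preimage (continuous_restrict_window E)
  have h1 := ProbabilityMeasure.tendsto_measure_of_isClopen_of_tendsto hlim hC
  have h2 := ProbabilityMeasure.tendsto_measure_of_isClopen_of_tendsto hπ hC
  have hcast : Tendsto (fun k => ((n k : ℕ) : ℤ)) atTop atTop :=
    tendsto_natCast_atTop_atTop.comp (StrictMono.tendsto_atTop fun _ _ hij => hn hij)
  have hwin : ∀ᶠ k in atTop, ∀ e ∈ E, ∀ f ∈ markWindow e,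
      sectionFace (n k) (projFace (n k) f) = f := by
    simp only [Finset.eventually_all]
    intro e _ f _
    filter_upwards [hcast.eventually_gt_atTop |f.1|, hcast.eventually_gt_atTop |f.2|] with k g1 g2
    exact sectionFace_projFace _ g1 g2
  have h3 := tendsto_nhds_unique h1 (h2.congr' ?_)
  · have h4 := congrArg ((↑) : NNReal → ENNReal) h3
    rwa [ProbabilityMeasure.ennreal_coeFn_eq_coeFn_toMeasure,
      ProbabilityMeasure.ennreal_coeFn_eq_coeFn_toMeasure] at h4
  filter_upwards [hwin] with k hk
  rw [← ENNReal.coe_inj, ProbabilityMeasure.ennreal_coeFn_eq_coeFn_toMeasure,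
    ProbabilityMeasure.ennreal_coeFn_eq_coeFn_toMeasure]
  exact (boltzmannPlane_shuffle (n k) ha hw h E hk S).symm

/-! ### Gauge equivalence on the plane -/

theorem GaugeEquivalent.mul_eq {a : ℝ} (ha : 0 < a) {w : Side → ℝ}
    (h : GaugeEquivalent (originalWeight a) (edgeWeight w : Edge ℤ → ℝ)) :
    a * (w .north * w .south) = w .east * w .west := by
  obtain ⟨g, -, h⟩ := h
  have hE : Alternating (IsEvenFace (R := ℤ)) := ⟨isEvenFace_int_fst, isEvenFace_int_snd⟩
  have h0 : IsEvenFace ((0, 0) : ℤ × ℤ) := by simp [IsEvenFace]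
  have hd (d : Side) := h (faceEdge (0, 0) d)
  simp only [edgeWeight, hE.owner_faceEdge h0] at hd
  rw [hd .north, hd .east, hd .south, hd .west]
  simp only [faceEdge, ends, originalWeight]
  linear_combination (-(g (0 - 1, 0) * g (0, 0) * (g (0 - 1, 0 - 1) * g (0, 0 - 1)))) *
    Real.mul_self_sqrt ha.le

theorem isEvenFace_int_iff (f : ℤ × ℤ) : IsEvenFace f ↔ (f.1 + f.2) % 2 = 0 := by
  rw [IsEvenFace, Int.even_iff]

/-- The condition that characterizes gauge-modified weights. The gauge is a geometric function
`c x ^ i y ^ j` on one colour class of the vertices and `x ^ (-i) y ^ (-j)` on the other one, so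
that the product at the ends of an edge depends only on the direction of the edge seen from the first
class. -/
theorem gaugeEquivalent_of_mul_eq {a : ℝ} (ha : 0 < a) {w : Side → ℝ} (hw : ∀ d, 0 < w d)
    (h : a * (w .north * w .south) = w .east * w .west) :
    GaugeEquivalent (originalWeight a) (edgeWeight w : Edge ℤ → ℝ) := by
  have hn := hw .north
  have he := hw .east
  have hs := hw .south
  have hv := hw .west
  have hsa := Real.sqrt_pos.2 ha
  let c := Real.sqrt (w .north * w .south)
  have hc : 0 < c := Real.sqrt_pos.2 (mul_pos hn hs)
  have hcc : c * c = w .north * w .south := Real.mul_self_sqrt (mul_pos hn hs).le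
  have hcc' : c * Real.sqrt a * (c * Real.sqrt a) = w .east * w .west := by
    rw [← h, ← hcc]
    linear_combination (c * c) * Real.mul_self_sqrt ha.le
  let x := w .north / c
  let y := w .east / (c * Real.sqrt a)
  have hx : 0 < x := div_pos hn hc
  have hy : 0 < y := div_pos he (mul_pos hc hsa)
  have hcx : c * x = w .north := by simp only [x]; field_simp
  have hcx' : c * x⁻¹ = w .south := by
    simp only [x]
    field_simp
    linear_combination hcc
  have hcy : c * y * Real.sqrt a = w .east := by simp only [y]; field_simp
  have hcy' : c * y⁻¹ * Real.sqrt a = w .west := by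
    simp only [y]
    field_simp
    linear_combination hcc'
  refine ⟨fun v => if (v.1 + v.2) % 2 = 0 then c * x ^ v.1 * y ^ v.2 else x ^ (-v.1) * y ^ (-v.2),
    fun v => ?_, fun e => ?_⟩
  · dsimp only
    split_ifs <;> positivity
  have hzx (i : ℤ) : x ^ (i - 1) = x ^ i * x⁻¹ := zpow_sub_one₀ hx.ne' i
  have hzy (i : ℤ) : y ^ (i - 1) = y ^ i * y⁻¹ := zpow_sub_one₀ hy.ne' i
  rcases e with ⟨i, j⟩ | ⟨i, j⟩
  all_goals
    have hxi : 0 < x ^ i := by positivity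
    have hyj : 0 < y ^ j := by positivity
    by_cases hp : (i + j) % 2 = 0
  · have hp' : (i - 1 + j) % 2 ≠ 0 := by lia
    simp only [edgeWeight, owner, isEvenFace_int_iff, hp, hp', if_true, if_false, ends,
      originalWeight, ← hcx, zpow_neg, hzx]
    field_simp
  · have hp' : (i - 1 + j) % 2 = 0 := by lia
    simp only [edgeWeight, owner, isEvenFace_int_iff, hp, hp', if_true, if_false, ends,
      originalWeight, ← hcx', zpow_neg, hzx]
    field_simp
  · have hp' : (i + (j - 1)) % 2 ≠ 0 := by lia
    simp only [edgeWeight, owner, isEvenFace_int_iff, hp, hp', if_true, if_false, ends,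
      originalWeight, ← hcy, zpow_neg, hzy]
    field_simp
  · have hp' : (i + (j - 1)) % 2 = 0 := by lia
    simp only [edgeWeight, owner, isEvenFace_int_iff, hp, hp', if_true, if_false, ends,
      originalWeight, ← hcy', zpow_neg, hzy]
    field_simp

/-! ### Existence of the Gibbs measures -/

theorem abs_add_abs_lt_of_mem_interior {ρ : ℝ × ℝ} (hρ : ρ ∈ interior newtonPolygon) :
    |ρ.1| + |ρ.2| < 2 := by
  -- the ray from the origin through `ρ` stays in the polygon for a while beyond `ρ`
  have hcont : Continuous fun t : ℝ => t • ρ := by fun_prop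
  have hmem : ∀ᶠ t : ℝ in 𝓝 1, t • ρ ∈ interior newtonPolygon :=
    hcont.continuousAt.eventually_mem (by simpa using isOpen_interior.mem_nhds hρ)
  obtain ⟨t, ht, ht1⟩ := ((hmem.filter_mono nhdsWithin_le_nhds).and
    (self_mem_nhdsWithin : Set.Ioi (1 : ℝ) ∈ 𝓝[>] (1 : ℝ))).exists
  have ht2 : |t * ρ.1| + |t * ρ.2| ≤ 2 := by
    have := interior_subset ht
    exact this
  have ht1' : 1 < t := ht1
  rw [abs_mul, abs_mul, abs_of_pos (by linarith : 0 < t)] at ht2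
  nlinarith [abs_nonneg ρ.1, abs_nonneg ρ.2]

/-- Angles with prescribed differences whose sines are gauge-modified weights. By the product
formulas, `2 sin α sin γ = cos (γ - α) + cos (β + δ)` and
`2 sin β sin δ = cos (β - δ) - cos (β + δ)`, so the condition determines `β + δ`. -/
theorem exists_angles {a : ℝ} (ha : 0 < a) {r t : ℝ} (h : |r| + |t| < Real.pi) :
    ∃ α β γ δ : ℝ, 0 < α ∧ 0 < β ∧ 0 < γ ∧ 0 < δ ∧ α + β + γ + δ = Real.pi ∧
      β - δ = r ∧ γ - α = t ∧
      a * (Real.sin α * Real.sin γ) = Real.sin β * Real.sin δ := by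
  have hr0 := abs_nonneg r
  have ht0 := abs_nonneg t
  have hcos : -Real.cos t < Real.cos r := by
    rw [← Real.cos_abs t, ← Real.cos_abs r, ← Real.cos_pi_sub]
    exact Real.cos_lt_cos_of_nonneg_of_le_pi hr0 (by linarith) (by linarith)
  let C := (Real.cos r - a * Real.cos t) / (1 + a)
  have h1a : 0 < 1 + a := by linarith
  have hC1 : C < Real.cos |r| := by
    rw [Real.cos_abs, div_lt_iff₀ h1a]
    nlinarith
  have hC2 : Real.cos (Real.pi - |t|) < C := by
    rw [Real.cos_pi_sub, Real.cos_abs, lt_div_iff₀ h1a]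
    nlinarith
  have hCS : Real.cos (Real.arccos C) = C :=
    Real.cos_arccos ((Real.neg_one_le_cos _).trans hC2.le) (hC1.le.trans (Real.cos_le_one _))
  have hS1 : |r| < Real.arccos C := by
    by_contra! hle
    have := Real.cos_le_cos_of_nonneg_of_le_pi (Real.arccos_nonneg C) (by linarith) hle
    linarith
  have hS2 : Real.arccos C < Real.pi - |t| := by
    by_contra! hle
    have := Real.cos_le_cos_of_nonneg_of_le_pi (by linarith) (Real.arccos_le_pi C) hle
    linarith
  generalize Real.arccos C = S at hCS hS1 hS2
  have g1 := neg_abs_le r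
  have g2 := le_abs_self r
  have g3 := neg_abs_le t
  have g4 := le_abs_self t
  refine ⟨(Real.pi - S - t) / 2, (S + r) / 2, (Real.pi - S + t) / 2, (S - r) / 2, by linarith,
    by linarith, by linarith, by linarith, by ring, by ring, by ring, ?_⟩
  have e1 : 2 * Real.sin ((Real.pi - S - t) / 2) * Real.sin ((Real.pi - S + t) / 2) =
      Real.cos t + Real.cos S := by
    rw [Real.two_mul_sin_mul_sin, show (Real.pi - S - t) / 2 - (Real.pi - S + t) / 2 = -t by ring,
      show (Real.pi - S - t) / 2 + (Real.pi - S + t) / 2 = Real.pi - S by ring, Real.cos_neg,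
      Real.cos_pi_sub, sub_neg_eq_add]
  have e2 : 2 * Real.sin ((S + r) / 2) * Real.sin ((S - r) / 2) = Real.cos r - Real.cos S := by
    rw [Real.two_mul_sin_mul_sin]
    congr 2 <;> ring
  have e3 : C * (1 + a) = Real.cos r - a * Real.cos t := div_mul_cancel₀ _ h1a.ne'
  rw [hCS] at e1 e2
  linear_combination (a / 2) * e1 - e2 / 2 + e3 / 2

/-- The Boltzmann measures on the tori have a limit point, since the dimer coverings of the plane
form a compact metrizable space. -/
theorem exists_tendsto_boltzmannPlane {w : Side → ℝ} (hw : ∀ d, 0 < w d) :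
    ∃ (π : ProbabilityMeasure (DimerCovering ℤ)) (n : ℕ → ℕ+), StrictMono n ∧
      Tendsto (fun k => boltzmannPlane (n k) hw) atTop (𝓝 π) := by
  have hclosed : IsClosed {M : Edge ℤ → Bool | IsCovering M} := by
    simp only [IsCovering, existsUnique_side, Set.ofPred_forall]
    refine isClosed_iInter fun v => ?_
    have hc : Continuous fun (M : Edge ℤ → Bool) d => M (vertexEdge v d) := by fun_prop
    exact (isClosed_discrete {X : Side → Bool | ((X .north && !X .east && !X .south && !X .west) ||
      (!X .north && X .east && !X .south && !X .west) ||
      (!X .north && !X .east && X .south && !X .west) ||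
      (!X .north && !X .east && !X .south && X .west)) = true}).preimage hc
  have hcomp : CompactSpace (DimerCovering ℤ) := isCompact_iff_compactSpace.1 hclosed.isCompact
  obtain ⟨π, φ, hφ, hπ⟩ := CompactSpace.tendsto_subseq fun k : ℕ => boltzmannPlane k.succPNat hw
  exact ⟨π, fun k => (φ k).succPNat, fun i j hij => Nat.succPNat_lt_succPNat.2 (hφ hij), hπ⟩

theorem exists_isSlopeGibbs {a : ℝ} (ha : 0 < a) {ρ : ℝ × ℝ} (hρ : ρ ∈ interior newtonPolygon) :
    ∃ π : ProbabilityMeasure (DimerCovering ℤ), IsSlopeGibbs a ρ π := by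
  have hpi := Real.pi_pos
  have hlt := abs_add_abs_lt_of_mem_interior hρ
  obtain ⟨α, β, γ, δ, hα, hβ, hγ, hδ, hsum, h1, h2, hsin⟩ :=
    exists_angles ha (r := ρ.1 * (Real.pi / 2)) (t := ρ.2 * (Real.pi / 2)) (by
      rw [abs_mul, abs_mul, abs_of_pos (half_pos hpi)]
      nlinarith)
  have hw : ∀ d, 0 < sineWeight α β γ δ d := fun d => by
    cases d <;> exact Real.sin_pos_of_pos_of_lt_pi (by assumption) (by linarith)
  obtain ⟨π, n, hn, hπ⟩ := exists_tendsto_boltzmannPlane hw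
  refine ⟨π, α, β, γ, δ, hα, hβ, hγ, hδ, hsum, ?_, ?_,
    gaugeEquivalent_of_mul_eq ha hw hsin, hw, n, hn, hπ⟩
  · rw [h1]
    field_simp
  · rw [h2]
    field_simp

theorem IsBoltzmannLimit.shuffleInvariant {a : ℝ} (ha : 0 < a) {w : Side → ℝ}
    {π : ProbabilityMeasure (DimerCovering ℤ)} (h : IsBoltzmannLimit a w π) :
    ShuffleInvariant a ha π := by
  obtain ⟨hg, hw, n, hn, hπ⟩ := h
  exact shuffleInvariant_of_tendsto ha hw (hg.mul_eq ha) hn hπ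

end Domino

theorem mainTheorem6 (a : ℝ) (ha : 0 < a) (ρ : ℝ × ℝ) (hρ : ρ ∈ interior Domino.newtonPolygon) :
    (∃ π : ProbabilityMeasure (Domino.DimerCovering ℤ), Domino.IsSlopeGibbs a ρ π) ∧
      (∀ π : ProbabilityMeasure (Domino.DimerCovering ℤ),
        Domino.IsSlopeGibbs a ρ π → Domino.ShuffleInvariant a ha π) ∧
      (∀ (w : Domino.Side → ℝ) (π : ProbabilityMeasure (Domino.DimerCovering ℤ)),
        Domino.IsBoltzmannLimit a w π → Domino.HasSlope π ρ →
          Domino.ShuffleInvariant a ha π) := by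
  refine ⟨Domino.exists_isSlopeGibbs ha hρ, ?_, fun w π h _ => h.shuffleInvariant ha⟩
  rintro π ⟨α, β, γ, δ, -, -, -, -, -, -, -, h⟩
  exact h.shuffleInvariant ha
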